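/- Let $(M,d)$ be a compact metric space and let $\Omega^+=M^{\mathbb N}$, with points $x=|x_1,x_2,\dots)$, metric $\sum_{i\ge1}2^{-i}d(x_i,y_i)$ and its Borel $\sigma$-algebra; $\Omega^-$ is the same space with points written $y=(\dots,y_2,y_1|$. Let $\sigma(|x_1,x_2,\dots))=|x_2,x_3,\dots)$ on $\Omega^+$, and let $\hat\sigma(\dots,y_2,y_1|x_1,x_2,\dots)=(\dots,y_2,y_1,x_1|x_2,x_3,\dots)$ on $\hat\Omega=\Omega^-\times\Omega^+$. An *a priori probability* is a Borel probability $\nu$ on $M$ with $\operatorname{supp}\nu=M$. A Lipschitz function $A:\Omega^+\to\mathbb R$ is *$\nu$-normalized* if $\int e^{A(|a,x_1,x_2,\dots))}\,d\nu(a)=1$ for every $x\in\Omega^+$; similarly, a Lipschitz function $B:\Omega^-\to\mathbb R$ is $\nu$-normalized if $\int e^{B((\dots,y_2,y_1,a|)}\,d\nu(a)=1$ for every $y\in\Omega^-$. A $\sigma$-invariant probability $\mu$ on $\Omega^+$ is an *equilibrium probability* if there are an a priori probability $\nu_0$ and a Lipschitz $\nu_0$-normalized function $A$ with $$\iint e^{A(|a,x_1,x_2,\dots))}f(|a,x_1,x_2,\dots))\,d\nu_0(a)\,d\mu(x)=\int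 f\,d\mu\quad\text{for all continuous } f:\Omega^+\to\mathbb R.$$ For an a priori probability $\nu$ and a probability $\eta$ on $\Omega^{+}$ or on $\Omega^-$, the *relative entropy* is $$h^\nu(\eta)=-\sup\Big\{\int B\,d\eta \;:\; B \text{ Lipschitz and } \nu\text{-normalized on the same space as } \eta\Big\}\in[-\infty,0].$$ **Proposition.** Let $\mu$ be an equilibrium probability on $\Omega^+$ and let $\nu$ be any a priori probability on $M$ (not necessarily the $\nu_0$ for which $\mu$ is an equilibrium). Then there is a unique $\hat\sigma$-invariant probability $\hat\mu$ on $\hat\Omega$ whose marginal on $\Omega^+$ is $\mu$, and, writing $\mu^-$ for the marginal of $\hat\mu$ on $\Omega^-$, $$h^\nu(\mu)=h^\nu(\mu^-),$$ as an equality in $[-\infty,0]$. -/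

import Mathlib

open MeasureTheory

namespace TFCA

/-- The space `M^ℕ` of one-sided sequences over the alphabet `M`, with the product topology and
the product (= Borel) sigma-algebra. It serves both as `Ω⁺`, whose points `|x₁, x₂, …)` are stored
as `x 0 = x₁, x 1 = x₂, …`, and as `Ω⁻`, whose points `(…, y₂, y₁|` are stored as
`y 0 = y₁, y 1 = y₂, …` (the symbol next to the bar always has index `0`). In this encoding the
conjugation `(…, z₂, z₁| ↦ |z₁, z₂, …)` between `Ω⁻` and `Ω⁺` is the identity. -/
abbrev Seq (M : Type*) := ℕ → M

/-- The two-sided space `Ω̂ = Ω⁻ × Ω⁺`, with points `(y | x)`. -/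
abbrev BiSeq (M : Type*) := Seq M × Seq M

/-- `cons a x = |a, x₁, x₂, …)`. -/
def cons {M : Type*} (a : M) (x : Seq M) : Seq M
  | 0 => a
  | i + 1 => x i

/-- The shift `σ(|x₁, x₂, x₃, …)) = |x₂, x₃, …)`. -/
def shift {M : Type*} (x : Seq M) : Seq M := fun i => x (i + 1)

/-- The bidirectional shift `σ̂(…, y₂, y₁ | x₁, x₂, …) = (…, y₂, y₁, x₁ | x₂, x₃, …)`. -/
def biShift {M : Type*} (z : BiSeq M) : BiSeq M := (cons (z.2 0) z.1, shift z.2)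

/-- The metric `d(x, y) = ∑_{i ≥ 1} d(xᵢ, yᵢ) / 2 ^ i` of the sequence space. -/
noncomputable def seqDist {M : Type*} [MetricSpace M] (x y : Seq M) : ℝ :=
  ∑' i : ℕ, dist (x i) (y i) / 2 ^ (i + 1)

/-- The series defining `seqDist` converges when `M` is compact. -/
theorem summable_seqDist {M : Type*} [MetricSpace M] [CompactSpace M] (x y : Seq M) :
    Summable fun i : ℕ => dist (x i) (y i) / 2 ^ (i + 1) := by
  have hb : Bornology.IsBounded (Set.univ : Set M) := isCompact_univ.isBounded
  refine Summable.of_nonneg_of_le (fun i => by positivity) (fun i => ?_)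
    ((summable_geometric_two.mul_left (Metric.diam (Set.univ : Set M))))
  have h1 : dist (x i) (y i) ≤ Metric.diam (Set.univ : Set M) :=
    Metric.dist_le_diam_of_mem hb (Set.mem_univ _) (Set.mem_univ _)
  have h2 : (0 : ℝ) < 2 ^ i := by positivity
  rw [one_div, inv_pow, ← div_eq_mul_inv]
  refine div_le_div₀ (dist_nonneg.trans h1) h1 h2 ?_
  rw [pow_succ]
  linarith

/-- Lipschitz functions on the sequence space, with respect to `seqDist`. -/
def IsLip {M : Type*} [MetricSpace M] (f : Seq M → ℝ) : Prop :=
  ∃ K : ℝ, 0 ≤ K ∧ ∀ x y : Seq M, |f x - f y| ≤ K * seqDist x y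

/-- An a priori probability on `M`: a Borel probability with support `M`. -/
structure IsAPriori {M : Type*} [MetricSpace M] [MeasurableSpace M] (ν : Measure M) : Prop where
  isProbabilityMeasure : IsProbabilityMeasure ν
  support_eq : ν.support = Set.univ

/-- The transfer operator `L_{A,ν}(f)(x) = ∫ e^{A(|a,x₁,x₂,…))} f(|a,x₁,x₂,…)) dν(a)`. -/
noncomputable def ruelle {M : Type*} [MeasurableSpace M] (A : Seq M → ℝ) (ν : Measure M)
    (f : Seq M → ℝ) (x : Seq M) : ℝ :=
  ∫ a, Real.exp (A (cons a x)) * f (cons a x) ∂ν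

/-- A `ν`-normalized function: `A` is Lipschitz and `L_{A,ν}(1) = 1`. -/
structure IsNormalized {M : Type*} [MetricSpace M] [MeasurableSpace M] (ν : Measure M)
    (A : Seq M → ℝ) : Prop where
  lip : IsLip A
  norm_eq : ∀ x : Seq M, ∫ a, Real.exp (A (cons a x)) ∂ν = 1

/-- A shift-invariant probability `μ` is an equilibrium probability if, for some a priori
probability `ν` and some Lipschitz `ν`-normalized function `A`, it is a fixed point of the dual
transfer operator, `L_{A,ν}^*(μ) = μ`. -/
structure IsEquilibrium {M : Type*} [MetricSpace M] [MeasurableSpace M]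
    (μ : Measure (Seq M)) : Prop where
  isProbabilityMeasure : IsProbabilityMeasure μ
  invariant : MeasurePreserving shift μ μ
  exists_potential : ∃ (ν : Measure M) (A : Seq M → ℝ), IsAPriori ν ∧ IsNormalized ν A ∧
    ∀ f : Seq M → ℝ, Continuous f → ∫ x, ruelle A ν f x ∂μ = ∫ x, f x ∂μ

/-- The relative entropy `h^ν(μ) = - sup {∫ B dμ | B is Lipschitz and ν-normalized}`, which may be
`-∞`. -/
noncomputable def relEntropy {M : Type*} [MetricSpace M] [MeasurableSpace M] (ν : Measure M)
    (μ : Measure (Seq M)) : EReal :=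
  -(⨆ (B : Seq M → ℝ) (_ : IsNormalized ν B), ((∫ x, B x ∂μ : ℝ) : EReal))

/-- `μ̂` is a `σ̂`-invariant probability on `Ω̂ = Ω⁻ × Ω⁺` extending `μ`, that is, with marginal `μ`
on `Ω⁺`. -/
structure IsInvariantExtension {M : Type*} [MeasurableSpace M] (μ : Measure (Seq M))
    (μhat : Measure (BiSeq M)) : Prop where
  isProbabilityMeasure : IsProbabilityMeasure μhat
  invariant : MeasurePreserving biShift μhat μhat
  extends_eq : μhat.map Prod.snd = μ

/-- The restriction (marginal) of `μ̂` to `Ω⁻`. When `μ̂` is the invariant extension of `μ`, this is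
the time reversal `μ⁻`. -/
noncomputable def pastMarginal {M : Type*} [MeasurableSpace M] (μhat : Measure (BiSeq M)) :
    Measure (Seq M) :=
  μhat.map Prod.fst

end TFCA

namespace TFCA

open Filter Topology

variable {M : Type*}

/-! Both parts rest on compactness and on invariance of `μ`. Extension: `biShift^[n] (y, x)` depends
less and less on `y`, uniformly in `x`. Hence an invariant extension is the limit of the images of
`μ` under `x ↦ biShift^[n] (y₀, x)`, which gives uniqueness, and a cluster point of these images
gives existence. Entropy: a normalized `B` on the future defines a chain that prepends symbols. The
words it produces have a density `pastDensity`, and the conditional density of a word's last symbol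
given the others is the exponential of a normalized potential on the past
(`isNormalized_reversedPotential`). If `S` bounds the integrals of all such potentials, telescoping
gives `∫ log pastDensity ≤ k * S`. By bounded distortion `log pastDensity` is at least the Birkhoff
sum of `B` minus a constant independent of `k`, and that sum integrates to `k * ∫ B`. Dividing by
`k` gives `∫ B ≤ S`; swapping past and future gives the other inequality. -/

/-- The inverse of `biShift`. -/
def backShift (z : BiSeq M) : BiSeq M := (shift z.1, cons (z.1 0) z.2)

@[simp] theorem shift_cons (a : M) (x : Seq M) : shift (cons a x) = x := rfl

@[simp] theorem cons_shift (x : Seq M) : cons (x 0) (shift x) = x := by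
  funext i; cases i <;> rfl

@[simp] theorem cons_zero (a : M) (x : Seq M) : cons a x 0 = a := rfl

theorem backShift_biShift (z : BiSeq M) : backShift (biShift z) = z := by
  simp [backShift, biShift]

section Topology

variable [TopologicalSpace M]

theorem continuous_shift : Continuous (shift : Seq M → Seq M) :=
  continuous_pi fun i => continuous_apply (i + 1)

theorem continuous_cons : Continuous fun p : M × Seq M => cons p.1 p.2 := by
  refine continuous_pi fun i => ?_
  cases i with
  | zero => exact continuous_fst
  | succ i => exact (continuous_apply i).comp continuous_snd

theorem continuous_biShift : Continuous (biShift : BiSeq M → BiSeq M) :=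
  (continuous_cons.comp (((continuous_apply 0).comp continuous_snd).prodMk continuous_fst)).prodMk
    (continuous_shift.comp continuous_snd)

theorem continuous_backShift : Continuous (backShift : BiSeq M → BiSeq M) :=
  (continuous_shift.comp continuous_fst).prodMk
    (continuous_cons.comp (((continuous_apply 0).comp continuous_fst).prodMk continuous_snd))

end Topology

/-! ### The sequence metric and Lipschitz functions. -/

section Metric

variable [MetricSpace M]

theorem seqDist_nonneg (x y : Seq M) : 0 ≤ seqDist x y :=
  tsum_nonneg fun _ => by positivity

theorem seqDist_self (x : Seq M) : seqDist x x = 0 := by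
  simp [seqDist]

theorem IsLip.sub {f g : Seq M → ℝ} (hf : IsLip f) (hg : IsLip g) :
    IsLip fun x => f x - g x := by
  obtain ⟨K, hK0, hK⟩ := hf
  obtain ⟨L, hL0, hL⟩ := hg
  refine ⟨K + L, by positivity, fun x y => ?_⟩
  have h1 := hK x y
  have h2 := hL x y
  rw [abs_le] at *
  constructor <;> linarith

theorem hasSum_diam :
    HasSum (fun i : ℕ => Metric.diam (Set.univ : Set M) / 2 ^ (i + 1))
      (Metric.diam (Set.univ : Set M)) := by
  refine (hasSum_geometric_two' (Metric.diam (Set.univ : Set M))).congr_fun fun i => ?_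
  rw [pow_succ]
  field_simp

variable [CompactSpace M]

theorem seqDist_cons (a b : M) (x y : Seq M) :
    seqDist (cons a x) (cons b y) = dist a b / 2 + seqDist x y / 2 := by
  unfold seqDist
  rw [(summable_seqDist (cons a x) (cons b y)).tsum_eq_zero_add, ← tsum_div_const]
  simp only [cons, zero_add, pow_one]
  congr 1
  refine tsum_congr fun i => ?_
  rw [pow_succ _ (i + 1)]
  field_simp

theorem seqDist_eq_head_add_tail (x y : Seq M) :
    seqDist x y = dist (x 0) (y 0) / 2 + seqDist (shift x) (shift y) / 2 := by
  rw [← seqDist_cons, cons_shift, cons_shift]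

theorem dist_head_le (x y : Seq M) : dist (x 0) (y 0) ≤ 2 * seqDist x y := by
  have := seqDist_eq_head_add_tail x y
  have := seqDist_nonneg (shift x) (shift y)
  linarith

theorem seqDist_shift_le (x y : Seq M) : seqDist (shift x) (shift y) ≤ 2 * seqDist x y := by
  have := seqDist_eq_head_add_tail x y
  have := dist_nonneg (x := x 0) (y := y 0)
  linarith

theorem dist_term_le (x y : Seq M) (i : ℕ) :
    dist (x i) (y i) / 2 ^ (i + 1) ≤ Metric.diam (Set.univ : Set M) / 2 ^ (i + 1) := by
  gcongr
  exact Metric.dist_le_diam_of_mem isCompact_univ.isBounded (Set.mem_univ _) (Set.mem_univ _)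

theorem seqDist_le_diam (x y : Seq M) : seqDist x y ≤ Metric.diam (Set.univ : Set M) :=
  hasSum_le (dist_term_le x y) (summable_seqDist x y).hasSum hasSum_diam

theorem continuous_seqDist (x : Seq M) : Continuous fun y => seqDist y x := by
  unfold seqDist
  refine continuous_tsum (fun i => by fun_prop) (hasSum_diam (M := M)).summable fun i y => ?_
  rw [Real.norm_of_nonneg (by positivity)]
  exact dist_term_le y x i

theorem IsLip.continuous {f : Seq M → ℝ} (hf : IsLip f) : Continuous f := by
  obtain ⟨K, -, hK⟩ := hf
  refine continuous_iff_continuousAt.2 fun x => ?_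
  refine tendsto_iff_dist_tendsto_zero.2 ?_
  have h : Tendsto (fun y => K * seqDist y x) (𝓝 x) (𝓝 0) := by
    simpa [seqDist_self] using ((continuous_seqDist x).tendsto x).const_mul K
  exact squeeze_zero (fun _ => dist_nonneg) (fun y => hK y x) h

theorem IsLip.comp_shift {f : Seq M → ℝ} (hf : IsLip f) : IsLip fun x => f (shift x) := by
  obtain ⟨K, hK0, hK⟩ := hf
  refine ⟨K * 2, by positivity, fun x y => (hK _ _).trans ?_⟩
  rw [mul_assoc]
  exact mul_le_mul_of_nonneg_left (seqDist_shift_le x y) hK0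

end Metric

/-! ### Backward Birkhoff sums. -/

section BackwardSums

/-- The Birkhoff sum of `B` over the futures of the first `k` images of `(y | w)` under
`backShift`. -/
def backSum (B : Seq M → ℝ) : ℕ → Seq M → Seq M → ℝ
  | 0, _, _ => 0
  | k + 1, y, w => B (cons (y 0) w) + backSum B k (shift y) (cons (y 0) w)

theorem continuous_backSum [TopologicalSpace M] {B : Seq M → ℝ} (hB : Continuous B) (k : ℕ) :
    Continuous fun z : BiSeq M => backSum B k z.1 z.2 := by
  induction k with
  | zero => exact continuous_const
  | succ k ih =>
    exact (hB.comp (continuous_snd.comp continuous_backShift)).add (ih.comp continuous_backShift)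

variable [MetricSpace M] [CompactSpace M]

/-- Prepending a common symbol halves distances, so the constant in `w` reproduces itself, `K / 2 +
K / 2 = K`, and does not depend on `k`. The constant `C` in `y` may grow with `k`. -/
theorem backSum_lipschitz {B : Seq M → ℝ} {K : ℝ} (hK0 : 0 ≤ K)
    (hK : ∀ x y : Seq M, |B x - B y| ≤ K * seqDist x y) (k : ℕ) :
    ∃ C : ℝ, 0 ≤ C ∧ ∀ y y' w w' : Seq M,
      |backSum B k y w - backSum B k y' w'| ≤ C * seqDist y y' + K * seqDist w w' := by
  induction k with
  | zero =>
    refine ⟨0, le_rfl, fun y y' w w' => ?_⟩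
    simpa [backSum] using mul_nonneg hK0 (seqDist_nonneg w w')
  | succ k ih =>
    obtain ⟨C, hC0, hC⟩ := ih
    refine ⟨2 * K + 2 * C, by positivity, fun y y' w w' => ?_⟩
    have h1 := hK (cons (y 0) w) (cons (y' 0) w')
    have h2 := hC (shift y) (shift y') (cons (y 0) w) (cons (y' 0) w')
    rw [seqDist_cons] at h1 h2
    have h3 := mul_le_mul_of_nonneg_left (dist_head_le y y') hK0
    have h4 := mul_le_mul_of_nonneg_left (seqDist_shift_le y y') hC0
    simp only [backSum]
    rw [abs_le] at *
    constructor <;> nlinarith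

end BackwardSums

/-! ### Dual transfer operator, word densities and comparison of entropies. -/

section Transfer

variable [MetricSpace M]

theorem continuous_exp_backSum {B : Seq M → ℝ} (hB : Continuous B) (k : ℕ) (y : Seq M) :
    Continuous fun w => Real.exp (backSum B k y w) :=
  Real.continuous_exp.comp ((continuous_backSum hB k).comp (Continuous.prodMk_right y))

variable [MeasurableSpace M]

theorem isNormalized_zero {ν : Measure M} [IsProbabilityMeasure ν] :
    IsNormalized ν fun _ : Seq M => (0 : ℝ) :=
  ⟨⟨0, le_rfl, by simp⟩, by simp⟩

variable [CompactSpace M] [BorelSpace M]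

theorem integrable_of_continuous {X : Type*} [TopologicalSpace X] [CompactSpace X]
    [MeasurableSpace X] [OpensMeasurableSpace X] {μ : Measure X} [IsFiniteMeasure μ]
    {f : X → ℝ} (hf : Continuous f) : Integrable f μ :=
  hf.integrable_of_hasCompactSupport (HasCompactSupport.of_compactSpace f)

/-- The dual transfer operator `L_{B,ν}^*` acting on measures. -/
noncomputable def transferMeasure (B : Seq M → ℝ) (ν : Measure M) (m : Measure (Seq M)) :
    Measure (Seq M) :=
  ((ν.prod m).map fun p => cons p.1 p.2).withDensity fun x => ENNReal.ofReal (Real.exp (B x))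

variable {B : Seq M → ℝ} {ν : Measure M} [IsProbabilityMeasure ν]

theorem integral_transferMeasure (hB : Continuous B) (m : Measure (Seq M))
    [IsProbabilityMeasure m] {f : Seq M → ℝ} (hf : Continuous f) :
    ∫ x, f x ∂transferMeasure B ν m =
      ∫ a, ∫ w, Real.exp (B (cons a w)) * f (cons a w) ∂m ∂ν := by
  have hc : Continuous fun x => Real.exp (B x) * f x := (Real.continuous_exp.comp hB).mul hf
  have hm : Measurable fun x => ENNReal.ofReal (Real.exp (B x)) :=
    (Real.continuous_exp.comp hB).measurable.ennreal_ofReal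
  rw [transferMeasure, integral_withDensity_eq_integral_toReal_smul hm
    (Eventually.of_forall fun _ => ENNReal.ofReal_lt_top)]
  simp only [ENNReal.toReal_ofReal (Real.exp_pos _).le, smul_eq_mul]
  rw [integral_map continuous_cons.measurable.aemeasurable
    hc.measurable.aestronglyMeasurable, integral_prod]
  exact integrable_of_continuous (hc.comp continuous_cons)

theorem integral_transferMeasure_symm (hB : Continuous B) (m : Measure (Seq M))
    [IsProbabilityMeasure m] {f : Seq M → ℝ} (hf : Continuous f) :
    ∫ x, f x ∂transferMeasure B ν m =
      ∫ w, ∫ a, Real.exp (B (cons a w)) * f (cons a w) ∂ν ∂m := by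
  rw [integral_transferMeasure hB m hf, integral_integral_swap]
  exact integrable_of_continuous
    (((Real.continuous_exp.comp hB).mul hf).comp continuous_cons)

theorem isProbabilityMeasure_transferMeasure (hB : IsNormalized ν B) (m : Measure (Seq M))
    [IsProbabilityMeasure m] : IsProbabilityMeasure (transferMeasure B ν m) := by
  have h := integral_transferMeasure_symm (ν := ν) hB.lip.continuous m
    (continuous_const (y := (1 : ℝ)))
  simp only [mul_one, hB.norm_eq, integral_const, smul_eq_mul, probReal_univ] at h
  refine ⟨?_⟩
  rw [measureReal_def] at h
  exact (ENNReal.toReal_eq_one_iff _).1 h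

/-- The density, with respect to the product of copies of `ν`, of the word formed by the first `k`
symbols of the past `y` under the `B`-chain whose future is distributed according to `m`. -/
noncomputable def pastDensity (B : Seq M → ℝ) (k : ℕ) (m : Measure (Seq M)) (y : Seq M) : ℝ :=
  ∫ w, Real.exp (backSum B k y w) ∂m

theorem pastDensity_pos (hB : Continuous B) (k : ℕ) (m : Measure (Seq M))
    [IsProbabilityMeasure m] (y : Seq M) : 0 < pastDensity B k m y :=
  integral_exp_pos (integrable_of_continuous (continuous_exp_backSum hB k y))

theorem pastDensity_le (hB : Continuous B) {k : ℕ} {m : Measure (Seq M)} [IsProbabilityMeasure m]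
    {y y' : Seq M} {c : ℝ} (h : ∀ w, backSum B k y w ≤ c + backSum B k y' w) :
    Real.log (pastDensity B k m y) ≤ c + Real.log (pastDensity B k m y') := by
  rw [← Real.log_exp c, ← Real.log_mul (Real.exp_ne_zero c) (pastDensity_pos hB k m y').ne']
  refine Real.log_le_log (pastDensity_pos hB k m y) ?_
  rw [pastDensity, pastDensity, ← integral_const_mul]
  refine integral_mono (integrable_of_continuous (continuous_exp_backSum hB k y))
    ((integrable_of_continuous (continuous_exp_backSum hB k y')).const_mul _) fun w => ?_
  simp only [← Real.exp_add]
  exact Real.exp_le_exp.2 (h w)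

theorem isLip_log_pastDensity (hB : IsLip B) (k : ℕ) (m : Measure (Seq M))
    [IsProbabilityMeasure m] : IsLip fun y => Real.log (pastDensity B k m y) := by
  have hc := hB.continuous
  obtain ⟨K, hK0, hK⟩ := hB
  obtain ⟨C, hC0, hC⟩ := backSum_lipschitz hK0 hK k
  refine ⟨C, hC0, fun y y' => ?_⟩
  have h1 := pastDensity_le hc (m := m) (y := y) (y' := y') (k := k) (c := C * seqDist y y')
    fun w => by
      have := (abs_le.1 (hC y y' w w)).2
      rw [seqDist_self] at this
      linarith
  have h2 := pastDensity_le hc (m := m) (y := y') (y' := y) (k := k) (c := C * seqDist y y')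
    fun w => by
      have := (abs_le.1 (hC y y' w w)).1
      rw [seqDist_self] at this
      linarith
  rw [abs_le]
  constructor <;> linarith

/-- Bounded distortion: changing `w` moves the sum by at most `K` times the diameter, whatever `k`
and `m` are. -/
theorem exists_backSum_le_log_pastDensity (hB : IsLip B) :
    ∃ C : ℝ, ∀ (k : ℕ) (m : Measure (Seq M)) [IsProbabilityMeasure m] (y w : Seq M),
      backSum B k y w - C ≤ Real.log (pastDensity B k m y) := by
  have hc := hB.continuous
  obtain ⟨K, hK0, hK⟩ := hB
  refine ⟨K * Metric.diam (Set.univ : Set M), fun k m _ y w => ?_⟩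
  obtain ⟨C, hC0, hC⟩ := backSum_lipschitz hK0 hK k
  rw [Real.le_log_iff_exp_le (pastDensity_pos hc k m y)]
  have h : ∫ _, Real.exp (backSum B k y w - K * Metric.diam (Set.univ : Set M)) ∂m ≤
      pastDensity B k m y := by
    refine integral_mono (integrable_const _)
      (integrable_of_continuous (continuous_exp_backSum hc k y)) fun w' => ?_
    have h1 := (abs_le.1 (hC y y w w')).2
    rw [seqDist_self] at h1
    have h2 := mul_le_mul_of_nonneg_left (seqDist_le_diam w w') hK0
    exact Real.exp_le_exp.2 (by linarith)
  simpa using h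

/-- The logarithm of the conditional density of the last symbol given the preceding ones in the
`k + 1` words weighted by `pastDensity`. -/
noncomputable def reversedPotential (B : Seq M → ℝ) (ν : Measure M) (k : ℕ)
    (m : Measure (Seq M)) (y : Seq M) : ℝ :=
  Real.log (pastDensity B (k + 1) m y) -
    Real.log (pastDensity B k (transferMeasure B ν m) (shift y))

theorem isNormalized_reversedPotential (hB : IsNormalized ν B) (k : ℕ) (m : Measure (Seq M))
    [IsProbabilityMeasure m] : IsNormalized ν (reversedPotential B ν k m) := by
  have := isProbabilityMeasure_transferMeasure hB m
  have hc := hB.lip.continuous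
  refine ⟨(isLip_log_pastDensity hB.lip (k + 1) m).sub
    (isLip_log_pastDensity hB.lip k _).comp_shift, fun y => ?_⟩
  have hpos := pastDensity_pos hc k (transferMeasure B ν m) y
  simp only [reversedPotential, shift_cons, Real.exp_sub, Real.exp_log hpos,
    Real.exp_log (pastDensity_pos hc (k + 1) m _)]
  -- Integrating out the symbol next to the bar turns the future law `m` into `transferMeasure B ν
  -- m`, so the numerator integrates to the denominator.
  rw [integral_div, div_eq_one_iff_eq hpos.ne', pastDensity,
    integral_transferMeasure hc m (continuous_exp_backSum hc k y)]
  simp only [pastDensity, backSum, cons_zero, shift_cons, Real.exp_add]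

/-- The logarithm telescopes into reversed potentials, each of integral at most `S`. The law `m`
stays universally quantified because each step replaces it by its transfer. -/
theorem integral_log_pastDensity_le {η : Measure (Seq M)} [IsProbabilityMeasure η]
    (hη : MeasurePreserving shift η η) (hB : IsNormalized ν B) {S : ℝ}
    (hS : ∀ B', IsNormalized ν B' → ∫ y, B' y ∂η ≤ S) (k : ℕ) :
    ∀ (m : Measure (Seq M)) [IsProbabilityMeasure m],
      ∫ y, Real.log (pastDensity B k m y) ∂η ≤ k * S := by
  induction k with
  | zero => intro m _; simp [pastDensity, backSum]
  | succ k ih =>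
    intro m _
    have := isProbabilityMeasure_transferMeasure hB m
    have h1 := hS _ (isNormalized_reversedPotential hB k m)
    have hL := isLip_log_pastDensity hB.lip k (transferMeasure B ν m)
    have hc := hL.continuous
    have h2 := ih (transferMeasure B ν m)
    have h3 : ∫ y, Real.log (pastDensity B k (transferMeasure B ν m) (shift y)) ∂η =
        ∫ y, Real.log (pastDensity B k (transferMeasure B ν m) y) ∂η := by
      conv_rhs => rw [← hη.map_eq]
      rw [integral_map hη.measurable.aemeasurable hc.measurable.aestronglyMeasurable]
    unfold reversedPotential at h1
    rw [integral_sub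
      (integrable_of_continuous (isLip_log_pastDensity hB.lip (k + 1) m).continuous)
      (integrable_of_continuous hL.comp_shift.continuous), h3] at h1
    push_cast
    linarith

theorem integral_backSum {μhat : Measure (BiSeq M)} [IsProbabilityMeasure μhat]
    (hinv : MeasurePreserving backShift μhat μhat) (hB : Continuous B) (k : ℕ) :
    ∫ z, backSum B k z.1 z.2 ∂μhat = k * ∫ z, B z.2 ∂μhat := by
  induction k with
  | zero => simp [backSum]
  | succ k ih =>
    have hc1 : Continuous fun z : BiSeq M => B z.2 := hB.comp continuous_snd
    have hc2 := continuous_backSum hB k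
    have hc3 : Continuous fun z : BiSeq M => B z.2 + backSum B k z.1 z.2 := hc1.add hc2
    -- The left integrand is the right one composed with `backShift`.
    have h : ∫ z, backSum B (k + 1) z.1 z.2 ∂μhat =
        ∫ z, (B z.2 + backSum B k z.1 z.2) ∂μhat := by
      conv_rhs => rw [← hinv.map_eq]
      rw [integral_map hinv.measurable.aemeasurable hc3.measurable.aestronglyMeasurable]
      rfl
    rw [h, integral_add (integrable_of_continuous hc1) (integrable_of_continuous hc2), ih]
    push_cast
    ring

theorem integral_le_of_forall_integral_fst_le {μhat : Measure (BiSeq M)}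
    [IsProbabilityMeasure μhat] (hinv : MeasurePreserving backShift μhat μhat)
    (hB : IsNormalized ν B) {S : ℝ}
    (hS : ∀ B', IsNormalized ν B' → ∫ y, B' y ∂μhat.map Prod.fst ≤ S) :
    ∫ x, B x ∂μhat.map Prod.snd ≤ S := by
  have hc := hB.lip.continuous
  have := Measure.isProbabilityMeasure_map (μ := μhat) (f := Prod.fst)
    measurable_fst.aemeasurable
  have hη : MeasurePreserving (shift : Seq M → Seq M) (μhat.map Prod.fst) (μhat.map Prod.fst) := by
    refine ⟨continuous_shift.measurable, ?_⟩
    conv_rhs => rw [← hinv.map_eq]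
    rw [Measure.map_map continuous_shift.measurable measurable_fst,
      Measure.map_map measurable_fst hinv.measurable]
    rfl
  obtain ⟨C, hC⟩ := exists_backSum_le_log_pastDensity hB.lip
  rw [integral_map measurable_snd.aemeasurable hc.measurable.aestronglyMeasurable]
  set I := ∫ z, B z.2 ∂μhat
  have key : ∀ k : ℕ, k * (I - S) ≤ C := fun k => by
    have hl := (isLip_log_pastDensity hB.lip k (μhat.map Prod.fst)).continuous
    -- Any probability may serve as the future law here; the past marginal is one at hand.
    have h1 := integral_log_pastDensity_le hη hB hS k (μhat.map Prod.fst)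
    rw [integral_map measurable_fst.aemeasurable hl.measurable.aestronglyMeasurable] at h1
    have h2 : ∫ z, (backSum B k z.1 z.2 - C) ∂μhat ≤
        ∫ z, Real.log (pastDensity B k (μhat.map Prod.fst) z.1) ∂μhat :=
      integral_mono
        ((integrable_of_continuous (continuous_backSum hc k)).sub (integrable_const C))
        (integrable_of_continuous (hl.comp continuous_fst)) fun z => hC k _ z.1 z.2
    rw [integral_sub (integrable_of_continuous (continuous_backSum hc k)) (integrable_const C),
      integral_backSum hinv hc] at h2
    simp only [integral_const, probReal_univ, one_smul] at h2
    linarith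
  by_contra! hlt
  obtain ⟨k, hk⟩ := exists_lt_nsmul (sub_pos.2 hlt) C
  rw [nsmul_eq_mul] at hk
  exact absurd (key k) (not_le.2 hk)

theorem relEntropy_fst_le_snd {μhat : Measure (BiSeq M)}
    [IsProbabilityMeasure μhat] (hinv : MeasurePreserving backShift μhat μhat) :
    relEntropy ν (μhat.map Prod.fst) ≤ relEntropy ν (μhat.map Prod.snd) := by
  unfold relEntropy
  rw [EReal.neg_le_neg_iff]
  refine iSup₂_le fun B hB => ?_
  have hle : ∀ B', IsNormalized ν B' → ((∫ y, B' y ∂μhat.map Prod.fst : ℝ) : EReal) ≤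
      ⨆ (B : Seq M → ℝ) (_ : IsNormalized ν B), ((∫ y, B y ∂μhat.map Prod.fst : ℝ) : EReal) :=
    fun B' hB' => le_iSup₂_of_le B' hB' le_rfl
  generalize (⨆ (B : Seq M → ℝ) (_ : IsNormalized ν B),
    ((∫ y, B y ∂μhat.map Prod.fst : ℝ) : EReal)) = S at hle
  induction S with
  -- The zero potential is normalized, so the supremum is at least `0`.
  | bot => exact absurd (hle _ isNormalized_zero) (by simp)
  | top => exact le_top
  | coe S =>
    exact EReal.coe_le_coe_iff.2 <| integral_le_of_forall_integral_fst_le hinv hB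
      fun B' hB' => EReal.coe_le_coe_iff.1 (hle B' hB')

theorem relEntropy_snd_eq_fst {μhat : Measure (BiSeq M)} [IsProbabilityMeasure μhat]
    (hinv : MeasurePreserving biShift μhat μhat) :
    relEntropy ν (μhat.map Prod.snd) = relEntropy ν (μhat.map Prod.fst) := by
  have hb : Measurable (biShift : BiSeq M → BiSeq M) := continuous_biShift.measurable
  have hk : Measurable (backShift : BiSeq M → BiSeq M) := continuous_backShift.measurable
  refine le_antisymm ?_ (relEntropy_fst_le_snd ⟨hk, ?_⟩)
  -- `Prod.swap` conjugates `biShift` to `backShift` and exchanges the marginals.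
  · have := Measure.isProbabilityMeasure_map (μ := μhat) (f := Prod.swap)
      measurable_swap.aemeasurable
    have h : MeasurePreserving backShift (μhat.map Prod.swap) (μhat.map Prod.swap) := by
      refine ⟨hk, ?_⟩
      conv_rhs => rw [← hinv.map_eq]
      rw [Measure.map_map hk measurable_swap, Measure.map_map measurable_swap hb]
      rfl
    have h2 := relEntropy_fst_le_snd (ν := ν) h
    rwa [Measure.map_map measurable_fst measurable_swap,
      Measure.map_map measurable_snd measurable_swap] at h2
  · conv_lhs => rw [← hinv.map_eq]
    rw [Measure.map_map hk hb]
    simp [Function.comp_def, backShift_biShift]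

end Transfer

/-! ### Existence and uniqueness of the invariant extension. -/

section Extension

theorem biShift_iterate_fst_of_lt (n : ℕ) (y y' x : Seq M) {i : ℕ} (hi : i < n) :
    (biShift^[n] (y, x)).1 i = (biShift^[n] (y', x)).1 i ∧
      (biShift^[n] (y, x)).2 = (biShift^[n] (y', x)).2 := by
  induction n generalizing i with
  | zero => omega
  | succ n ih =>
    have h2 : (biShift^[n] (y, x)).2 = (biShift^[n] (y', x)).2 := by
      cases n with
      | zero => rfl
      | succ n => exact (ih n.succ_pos).2
    simp only [Function.iterate_succ_apply', biShift, h2, and_true]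
    cases i with
    | zero => rfl
    | succ i => exact (ih (by omega)).1

theorem biShift_iterate_snd (n : ℕ) (y y' x : Seq M) :
    (biShift^[n] (y, x)).2 = (biShift^[n] (y', x)).2 := by
  cases n with
  | zero => rfl
  | succ n => exact (biShift_iterate_fst_of_lt _ y y' x n.succ_pos).2

theorem biShift_iterate_snd_eq (n : ℕ) (z : BiSeq M) : (biShift^[n] z).2 = shift^[n] z.2 := by
  induction n generalizing z with
  | zero => rfl
  | succ n ih => exact ih (biShift z)

variable [MetricSpace M] [CompactSpace M]

/-- Continuous functions forget the remote past, uniformly. -/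
theorem tendsto_sub_biShift_iterate {f : BiSeq M → ℝ} (hf : Continuous f) {ε : ℝ} (hε : 0 < ε) :
    ∀ᶠ n in atTop, ∀ y y' x : Seq M,
      |f (biShift^[n] (y, x)) - f (biShift^[n] (y', x))| < ε := by
  have hu := CompactSpace.uniformContinuous_of_continuous hf
  have ht : Tendsto (fun p : ℕ × (Seq M × Seq M × Seq M) =>
      (biShift^[p.1] (p.2.1, p.2.2.2), biShift^[p.1] (p.2.2.1, p.2.2.2)))
      (atTop ×ˢ ⊤) (uniformity (BiSeq M)) := by
    -- The product uniformity sees one coordinate at a time: past coordinate `i` agrees exactly once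
    -- `n > i`, and the futures always agree.
    rw [uniformity_prod, tendsto_inf, tendsto_comap_iff, tendsto_comap_iff]
    constructor
    · rw [Pi.uniformity, tendsto_iInf]
      intro i
      rw [tendsto_comap_iff]
      refine tendsto_def.2 fun s hs => mem_prod_top.2 ?_
      filter_upwards [eventually_gt_atTop i] with n hn p
      exact mem_uniformity_of_eq hs (biShift_iterate_fst_of_lt n _ _ _ hn).1
    · refine tendsto_def.2 fun s hs => mem_prod_top.2 (Eventually.of_forall fun n p => ?_)
      exact mem_uniformity_of_eq hs (biShift_iterate_snd n _ _ _)
  filter_upwards [mem_prod_top.1 (Tendsto.comp hu ht (Metric.dist_mem_uniformity hε))] with n hn y y' x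
  exact hn (y, y', x)

theorem abs_integral_sub_le {X : Type*} [TopologicalSpace X] [CompactSpace X]
    [MeasurableSpace X] [OpensMeasurableSpace X] {μ : Measure X} [IsProbabilityMeasure μ]
    {f g : X → ℝ} (hf : Continuous f) (hg : Continuous g) {ε : ℝ} (h : ∀ x, |f x - g x| ≤ ε) :
    |∫ x, f x ∂μ - ∫ x, g x ∂μ| ≤ ε := by
  rw [← integral_sub (integrable_of_continuous hf) (integrable_of_continuous hg)]
  simpa using norm_integral_le_of_norm_le_const (μ := μ) (f := fun x => f x - g x)
    (Eventually.of_forall h)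

variable [MeasurableSpace M] [BorelSpace M]

/-- The approximating integrals involve only `μ` and `y₀`, so the limit determines `μhat`. -/
theorem IsInvariantExtension.tendsto_integral {μ : Measure (Seq M)} {μhat : Measure (BiSeq M)}
    (h : IsInvariantExtension μ μhat) (y₀ : Seq M) {f : BiSeq M → ℝ} (hf : Continuous f) :
    Tendsto (fun n => ∫ x, f (biShift^[n] (y₀, x)) ∂μ) atTop (𝓝 (∫ z, f z ∂μhat)) := by
  have := h.isProbabilityMeasure
  have hc : ∀ n, Continuous fun z : BiSeq M => f (biShift^[n] z) := fun n =>
    hf.comp (continuous_biShift.iterate n)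
  have hc' : ∀ n, Continuous fun x : Seq M => f (biShift^[n] (y₀, x)) := fun n =>
    (hc n).comp (Continuous.prodMk_right y₀)
  rw [Metric.tendsto_atTop']
  intro ε hε
  obtain ⟨N, hN⟩ := eventually_atTop.1 (tendsto_sub_biShift_iterate hf (half_pos hε))
  refine ⟨N, fun n hn => ?_⟩
  have h1 : ∫ x, f (biShift^[n] (y₀, x)) ∂μ = ∫ z, f (biShift^[n] (y₀, z.2)) ∂μhat := by
    rw [← h.extends_eq, integral_map measurable_snd.aemeasurable
      (hc' n).measurable.aestronglyMeasurable]
  have h2 : ∫ z, f z ∂μhat = ∫ z, f (biShift^[n] z) ∂μhat := by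
    have hi := h.invariant.iterate n
    conv_lhs => rw [← hi.map_eq]
    rw [integral_map hi.measurable.aemeasurable hf.measurable.aestronglyMeasurable]
  rw [h1, h2, Real.dist_eq]
  refine (abs_integral_sub_le ((hc' n).comp continuous_snd) (hc n) fun z => ?_).trans_lt
    (half_lt_self hε)
  exact (hN n hn.le y₀ z.1 z.2).le

theorem IsInvariantExtension.unique {μ : Measure (Seq M)} {μ₁ μ₂ : Measure (BiSeq M)}
    (h₁ : IsInvariantExtension μ μ₁) (h₂ : IsInvariantExtension μ μ₂) : μ₁ = μ₂ := by
  have := h₁.isProbabilityMeasure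
  have := h₂.isProbabilityMeasure
  obtain ⟨z⟩ := nonempty_of_isProbabilityMeasure μ₁
  exact ext_of_forall_integral_eq_of_IsFiniteMeasure fun f =>
    tendsto_nhds_unique (h₁.tendsto_integral z.1 f.continuous)
      (h₂.tendsto_integral z.1 f.continuous)

theorem exists_isInvariantExtension {μ : Measure (Seq M)} [IsProbabilityMeasure μ]
    (hμ : MeasurePreserving shift μ μ) : ∃ μhat : Measure (BiSeq M), IsInvariantExtension μ μhat := by
  obtain ⟨y₀⟩ := nonempty_of_isProbabilityMeasure μ
  have hΦ : ∀ n, Continuous fun x : Seq M => biShift^[n] (y₀, x) := fun n =>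
    (continuous_biShift.iterate n).comp (Continuous.prodMk_right y₀)
  let P : ℕ → ProbabilityMeasure (BiSeq M) := fun n =>
    ⟨μ.map fun x => biShift^[n] (y₀, x),
      Measure.isProbabilityMeasure_map (hΦ n).measurable.aemeasurable⟩
  have hP : ∀ n {f : BiSeq M → ℝ}, Continuous f →
      ∫ z, f z ∂(P n : Measure (BiSeq M)) = ∫ x, f (biShift^[n] (y₀, x)) ∂μ := fun n f hf =>
    integral_map (hΦ n).measurable.aemeasurable hf.measurable.aestronglyMeasurable
  -- Compactness of the space of probabilities gives a limit along an ultrafilter, with no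
  -- subsequence to extract.
  obtain ⟨Q, -, hQ⟩ := isCompact_univ.ultrafilter_le_nhds ((hyperfilter ℕ).map P) (by simp)
  have hQ' : Tendsto P (hyperfilter ℕ) (𝓝 Q) := hQ
  have hlim : ∀ {f : BiSeq M → ℝ}, Continuous f →
      Tendsto (fun n => ∫ x, f (biShift^[n] (y₀, x)) ∂μ) (hyperfilter ℕ)
        (𝓝 (∫ z, f z ∂(Q : Measure (BiSeq M)))) := fun {f} hf => by
    refine Tendsto.congr (fun n => hP n hf) ?_
    exact ProbabilityMeasure.tendsto_iff_forall_integral_tendsto.1 hQ'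
      (BoundedContinuousFunction.mkOfCompact ⟨f, hf⟩)
  have htop : (hyperfilter ℕ : Filter ℕ) ≤ atTop := Nat.hyperfilter_le_atTop
  refine ⟨Q, inferInstance, ⟨continuous_biShift.measurable, ?_⟩, ?_⟩
  · have := Measure.isProbabilityMeasure_map (μ := (Q : Measure (BiSeq M)))
      continuous_biShift.measurable.aemeasurable
    refine ext_of_forall_integral_eq_of_IsFiniteMeasure fun f => ?_
    have hf := f.continuous
    rw [integral_map continuous_biShift.measurable.aemeasurable
      hf.measurable.aestronglyMeasurable]
    have hz : Tendsto (fun n => ∫ x, f (biShift (biShift^[n] (y₀, x))) ∂μ -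
        ∫ x, f (biShift^[n] (y₀, x)) ∂μ) atTop (𝓝 0) := by
      rw [Metric.tendsto_atTop']
      intro ε hε
      obtain ⟨N, hN⟩ := eventually_atTop.1 (tendsto_sub_biShift_iterate hf (half_pos hε))
      refine ⟨N, fun n hn => ?_⟩
      have hc := hf.comp (hΦ n)
      have hs : ∫ x, f (biShift^[n] (y₀, x)) ∂μ = ∫ x, f (biShift^[n] (y₀, shift x)) ∂μ := by
        conv_lhs => rw [← hμ.map_eq]
        exact integral_map hμ.measurable.aemeasurable hc.measurable.aestronglyMeasurable
      rw [hs, Real.dist_eq, sub_zero]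
      refine (abs_integral_sub_le (hf.comp (continuous_biShift.comp (hΦ n)))
        (hc.comp continuous_shift) fun x => ?_).trans_lt (half_lt_self hε)
      -- One extra `biShift` sends `(y₀, x)` to `(cons (x 0) y₀, shift x)`, which differs from `(y₀,
      -- shift x)` only in the past.
      have hx := hN n hn.le (cons (x 0) y₀) y₀ (shift x)
      simp only [Function.comp_apply, ← Function.iterate_succ_apply' biShift]
      exact hx.le
    have hd := (hlim (hf.comp continuous_biShift)).sub (hlim hf)
    exact sub_eq_zero.1 (tendsto_nhds_unique hd (hz.mono_left htop))
  · have := Measure.isProbabilityMeasure_map (μ := (Q : Measure (BiSeq M)))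
      (f := Prod.snd) measurable_snd.aemeasurable
    refine ext_of_forall_integral_eq_of_IsFiniteMeasure fun f => ?_
    have hf := f.continuous
    rw [integral_map measurable_snd.aemeasurable hf.measurable.aestronglyMeasurable]
    refine tendsto_nhds_unique (hlim (hf.comp continuous_snd)) ?_
    -- By invariance of `μ` the sequence is constant in `n`.
    refine tendsto_const_nhds.congr fun n => ?_
    have hi := hμ.iterate n
    conv_lhs => rw [← hi.map_eq]
    rw [integral_map hi.measurable.aemeasurable hf.measurable.aestronglyMeasurable]
    simp only [biShift_iterate_snd_eq]

end Extension

end TFCA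

theorem mainTheorem7 {M : Type*} [MetricSpace M] [CompactSpace M] [MeasurableSpace M]
    [BorelSpace M] (μ : Measure (TFCA.Seq M)) (hμ : TFCA.IsEquilibrium μ)
    (ν : Measure M) (hν : TFCA.IsAPriori ν) :
    (∃! μhat : Measure (TFCA.BiSeq M), TFCA.IsInvariantExtension μ μhat) ∧
      ∀ μhat : Measure (TFCA.BiSeq M), TFCA.IsInvariantExtension μ μhat →
        TFCA.relEntropy ν μ = TFCA.relEntropy ν (TFCA.pastMarginal μhat) := by
  have := hμ.isProbabilityMeasure
  have := hν.isProbabilityMeasure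
  obtain ⟨μhat, h⟩ := TFCA.exists_isInvariantExtension hμ.invariant
  refine ⟨⟨μhat, h, fun μ' h' => h'.unique h⟩, fun μ' h' => ?_⟩
  have := h'.isProbabilityMeasure
  rw [← h'.extends_eq]
  exact TFCA.relEntropy_snd_eq_fst h'.invariant
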